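/- Let $t\ge 4$ be an even integer with $t\neq 8$. (1) There exists a $(4t,4,\{3,5\},1)$-perfect difference family, i.e. a family $\mathcal F$ of subsets (base blocks) of $\mathbb Z_{4t}$, each of size $3$ or $5$ and each containing $0$, such that - the differences $x-y$ ($x,y\in B$, $x\ne y$, $B\in\mathcal F$) cover every element of $\mathbb Z_{4t}\setminus\{0,t,2t,3t\}$ exactly once and no element of $\{0,t,2t,3t\}$; and - every nonzero element of every base block is the residue of some integer $a$ with $0\le a\le 2t$ and $a\not\equiv 0 \pmod t$. (2) There exists a perfect $3$-SCHGDD (semi-cyclic holey group divisible design with block size 3) of type $(3,4^t)$. That is, put $S=\{0,t,2t,3t\}\subset\mathbb Z_{4t}$, $I_3=\{0,1,2\}$; there is a family $\mathcal B^*$ of $3$-subsets of $I_3\times\mathbb Z_{4t}$ such that - for all $i\neq j$ in $I_3$, the list of differences $x-y$ over all $(i,x),(j,y)\in B$, $B\in\mathcal B^*$, contains each element of $\mathbb Z_{4t}\setminus S$ exactly once and no element of $S$; and no $B\in\mathcal B^*$ contains two distinct points with the same first coordinate; - the set of all translates of the base blocks under $(i,x)\mapsto(i,x+c)$, $c\in\mathbb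 Z_{4t}$, is the block set of a $3$-HGDD of type $(3,4^t)$ on $I_3\times \mathbb Z_{4t}$ with groups $\{i\}\times\mathbb Z_{4t}$ ($i\in I_3$) and holes $I_3\times(S+l)$ ($0\le l\le t-1$): no block contains two distinct points of a group or of a hole, and any other pair of distinct points lies in exactly one block; and - (perfectness) each $B\in\mathcal B^*$ has a point with second coordinate $0$, and the second coordinate of every other point of $B$ is the residue of an integer $a$ with $0\le a\le 2t$ and $a\not\equiv 0\pmod t$. -/

import Mathlib

/-- The subgroup `{0, t, 2t, …, (m-1)t}` of order `m` in `Z_{mt}`. -/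
def holeSubgroup (m t : ℕ) : Finset (ZMod (m * t)) :=
  (Finset.range m).image fun i => ((i * t : ℕ) : ZMod (m * t))

/-- The list of differences `ΔB = {x - y : x, y ∈ B, x ≠ y}`, with multiplicities. -/
def blockDiffs {v : ℕ} (B : Finset (ZMod v)) : Multiset (ZMod v) :=
  B.offDiag.val.map fun p => p.1 - p.2

/-- `F` is a `(gt, g, K, 1)`-cyclic difference family: all block sizes lie in `K`, and the
differences cover each element of `Z_{gt} \ {0, t, …, (g-1)t}` exactly once and no other element. -/
structure IsCDF (g t : ℕ) (K : Set ℕ) (F : Multiset (Finset (ZMod (g * t)))) : Prop where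
  card_mem : ∀ B ∈ F, B.card ∈ K
  count_diff : ∀ d ∉ holeSubgroup g t, (F.bind blockDiffs).count d = 1
  hole_diff : ∀ d ∈ holeSubgroup g t, d ∉ F.bind blockDiffs

/-- The residues in `Z_{gt}` of the integers `a` with `0 ≤ a ≤ ⌊gt/2⌋` and `a ≢ 0 (mod t)`. -/
def perfectSet (g t : ℕ) : Set (ZMod (g * t)) :=
  {x | ∃ a : ℕ, a ≤ g * t / 2 ∧ ¬ t ∣ a ∧ x = (a : ZMod (g * t))}

/-- `F` is a `(gt, g, K, 1)`-perfect difference family: a cyclic difference family each of whose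
base blocks contains `0` and has all its other elements in `perfectSet g t`. -/
structure IsPDF (g t : ℕ) (K : Set ℕ) (F : Multiset (Finset (ZMod (g * t)))) : Prop where
  isCDF : IsCDF g t K F
  zero_mem : ∀ B ∈ F, (0 : ZMod (g * t)) ∈ B
  ele_subset : ∀ B ∈ F, ∀ x ∈ B, x ≠ 0 → x ∈ perfectSet g t

/-- A holey group divisible design (`K`-HGDD of type `(n, m^t)`) with point set the type `X`,
groups `G`, holes `H` and blocks `Bl`. -/
structure IsHGDD {X : Type*} (K : Set ℕ) (n m t : ℕ)
    (G H : Set (Set X)) (Bl : Set (Finset X)) : Prop where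
  finite : Finite X
  card_points : Nat.card X = n * m * t
  groups_partition : Setoid.IsPartition G
  groups_number : G.ncard = n
  group_size : ∀ g ∈ G, g.ncard = m * t
  holes_partition : Setoid.IsPartition H
  holes_number : H.ncard = t
  hole_size : ∀ h ∈ H, h.ncard = n * m
  hole_inter_group : ∀ h ∈ H, ∀ g ∈ G, (h ∩ g).ncard = m
  block_size : ∀ b ∈ Bl, b.card ∈ K
  block_group : ∀ b ∈ Bl, ∀ g ∈ G, ∀ x ∈ b, ∀ y ∈ b, x ∈ g → y ∈ g → x = y
  block_hole : ∀ b ∈ Bl, ∀ h ∈ H, ∀ x ∈ b, ∀ y ∈ b, x ∈ h → y ∈ h → x = y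
  pair_unique : ∀ x y : X, x ≠ y → (∀ g ∈ G, ¬ (x ∈ g ∧ y ∈ g)) →
    (∀ h ∈ H, ¬ (x ∈ h ∧ y ∈ h)) → ∃! b, b ∈ Bl ∧ x ∈ b ∧ y ∈ b

/-- The groups `{i} × Z_{mt}`, `i ∈ I_n`. -/
def stdGroups (n m t : ℕ) : Set (Set (Fin n × ZMod (m * t))) :=
  {g | ∃ i : Fin n, g = {p | p.1 = i}}

/-- The holes `I_n × (S + l)`, `0 ≤ l ≤ t - 1`, with `S = {0, t, …, (m-1)t}`. -/
def stdHoles (n m t : ℕ) : Set (Set (Fin n × ZMod (m * t))) :=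
  {h | ∃ l : ℕ, l < t ∧ h = {p | p.2 - (l : ZMod (m * t)) ∈ holeSubgroup m t}}

/-- The list `Δ_{ij}(B) = {x - y : (i, x), (j, y) ∈ B, (i, x) ≠ (j, y)}`, with multiplicities. -/
def mixedDiffs {n v : ℕ} (i j : Fin n) (B : Finset (Fin n × ZMod v)) : Multiset (ZMod v) :=
  (B.offDiag.filter fun p => p.1.1 = i ∧ p.2.1 = j).val.map fun p => p.1.2 - p.2.2

/-- All translates of the base blocks under the maps `(i, x) ↦ (i, x + c)`. -/
def develop {n v : ℕ} (F : Multiset (Finset (Fin n × ZMod v))) : Set (Finset (Fin n × ZMod v)) :=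
  {b | ∃ A ∈ F, ∃ c : ZMod v, b = A.image fun p => (p.1, p.2 + c)}

/-- `F` is the family of base blocks of a `k`-SCHGDD of type `(n, m^t)` on `I_n × Z_{mt}`. -/
structure IsSCHGDD (k n m t : ℕ) (F : Multiset (Finset (Fin n × ZMod (m * t)))) : Prop where
  card_eq : ∀ B ∈ F, B.card = k
  count_diff : ∀ i j : Fin n, i ≠ j → ∀ d ∉ holeSubgroup m t,
    (F.bind (mixedDiffs i j)).count d = 1
  hole_diff : ∀ i j : Fin n, i ≠ j → ∀ d ∈ holeSubgroup m t, d ∉ F.bind (mixedDiffs i j)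
  pure_diff : ∀ i : Fin n, F.bind (mixedDiffs i i) = 0
  isHGDD : IsHGDD {k} n m t (stdGroups n m t) (stdHoles n m t) (develop F)

/-- `F` is the family of base blocks of a perfect `k`-SCHGDD of type `(n, m^t)`: each base block
has one point with second coordinate `0`, and the second coordinates of all its other points lie
in `perfectSet m t`. -/
structure IsPerfectSCHGDD (k n m t : ℕ) (F : Multiset (Finset (Fin n × ZMod (m * t)))) :
    Prop where
  isSCHGDD : IsSCHGDD k n m t F
  perfect : ∀ B ∈ F, ∃ p ∈ B, p.2 = 0 ∧ ∀ q ∈ B, q ≠ p → q.2 ∈ perfectSet m t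

/-! Both parts reduce to a problem about integers: find sets of sizes 3 and 5, each containing 0,
whose positive differences are exactly 1, …, 2t - 1 without t, each occurring once. Taken modulo 4t,
these differences and their negatives run once through everything outside {0, t, 2t, 3t}, and all
marks are below 2t, so the sets form a perfect difference family (`isPDF_of_bind_posDiffs`). Since
the number of differences is right, it suffices that every required value occurs
(`exists_isPDF_of_lists`). With a triples and b quintuples the count is 3a + 10b = 2t - 2, so b ≡ 2t
- 2 (mod 3). For t = 8 this has no solution; for t = 6s, 6s + 2, 6s + 4 the constructions use the
least possible b = 1, 2, 0. Each takes three long runs of triples {0, a + 2i, c + i} and closes the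
remaining gaps with boundedly many sporadic blocks. The small t are treated by explicit lists. For
the second part, label a block by Z_3 or Z_5 and take all triples (x, y, 2y - x) with x ≠ y. Any two
coordinates run once through the ordered pairs of distinct points (`exists_transversal_triples`), so
the mixed differences between any two groups are again the differences of the family. Translating
each triple to make its least coordinate 0 gives perfectness (`IsPDF.exists_isPerfectSCHGDD`), and
the difference conditions alone force the holey design (`isHGDD_develop`). -/

/-! ### The hole subgroup. -/

theorem mem_holeSubgroup {m t : ℕ} (hm : 0 < m) (ht : 0 < t) (x : ZMod (m * t)) :
    x ∈ holeSubgroup m t ↔ t ∣ x.val := by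
  have : NeZero (m * t) := ⟨(Nat.mul_pos hm ht).ne'⟩
  simp only [holeSubgroup, Finset.mem_image, Finset.mem_range]
  constructor
  · rintro ⟨i, hi, rfl⟩
    rw [ZMod.val_natCast_of_lt (Nat.mul_lt_mul_of_pos_right hi ht)]
    exact dvd_mul_left _ _
  · rintro ⟨k, hk⟩
    refine ⟨k, ?_, ?_⟩
    · have := ZMod.val_lt x
      rw [hk, mul_comm] at this
      exact Nat.lt_of_mul_lt_mul_right this
    · rw [mul_comm k t, ← hk, ZMod.natCast_zmod_val]

theorem natCast_mem_holeSubgroup {m t : ℕ} (hm : 0 < m) (ht : 0 < t) (a : ℕ) :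
    (a : ZMod (m * t)) ∈ holeSubgroup m t ↔ t ∣ a := by
  rw [mem_holeSubgroup hm ht, ZMod.val_natCast, Nat.dvd_mod_iff (dvd_mul_left t m)]

/-- The hole subgroup is the kernel of reduction modulo t; in this form its closure under
subtraction and negation comes from the homomorphism laws. -/
theorem mem_holeSubgroup_iff_castHom {m t : ℕ} (hm : 0 < m) (ht : 0 < t) (x : ZMod (m * t)) :
    x ∈ holeSubgroup m t ↔ ZMod.castHom (dvd_mul_left t m) (ZMod t) x = 0 := by
  have : NeZero (m * t) := ⟨(Nat.mul_pos hm ht).ne'⟩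
  obtain ⟨a, rfl⟩ := ZMod.natCast_zmod_surjective x
  rw [natCast_mem_holeSubgroup hm ht, map_natCast, ZMod.natCast_eq_zero_iff]

theorem card_holeSubgroup {m t : ℕ} (ht : 0 < t) : (holeSubgroup m t).card = m := by
  rw [holeSubgroup, Finset.card_image_of_injOn, Finset.card_range]
  intro i hi j hj h
  simp only [Finset.coe_range, Set.mem_Iio] at hi hj
  simp only [ZMod.natCast_eq_natCast_iff'] at h
  rw [Nat.mod_eq_of_lt (Nat.mul_lt_mul_of_pos_right hi ht),
    Nat.mod_eq_of_lt (Nat.mul_lt_mul_of_pos_right hj ht)] at h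
  exact Nat.eq_of_mul_eq_mul_right ht h

/-! ### Multiplicities in lists of differences. -/

theorem Multiset.one_le_count_bind {α β : Type*} [DecidableEq β] {F : Multiset α}
    {f : α → Multiset β} {a : α} (ha : a ∈ F) (b : β) :
    (f a).count b ≤ (F.bind f).count b := by
  obtain ⟨F', rfl⟩ := Multiset.exists_cons_of_mem ha
  rw [Multiset.cons_bind, Multiset.count_add]
  exact Nat.le_add_right _ _

/-- A difference of multiplicity one determines its base block; `Finset.eq_of_count_map_le_one` then
determines the pair inside that block. -/
theorem Multiset.eq_of_mem_of_count_bind_le_one {α β : Type*} [DecidableEq β] {F : Multiset α}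
    {f : α → Multiset β} {a a' : α} {b : β} (h : (F.bind f).count b ≤ 1) (ha : a ∈ F)
    (ha' : a' ∈ F) (hb : b ∈ f a) (hb' : b ∈ f a') : a = a' := by
  by_contra hne
  obtain ⟨F', rfl⟩ := Multiset.exists_cons_of_mem ha
  have ha'' : a' ∈ F' := (Multiset.mem_cons.1 ha').resolve_left (Ne.symm hne)
  rw [Multiset.cons_bind, Multiset.count_add] at h
  have h1 := Multiset.one_le_count_iff_mem.2 hb
  have h2 : 1 ≤ (F'.bind f).count b :=
    Multiset.one_le_count_iff_mem.2 (Multiset.mem_bind.2 ⟨a', ha'', hb'⟩)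
  omega

theorem Finset.eq_of_count_map_le_one {α β : Type*} [DecidableEq β] {s : Finset α} {f : α → β}
    {a a' : α} (h : (s.val.map f).count (f a) ≤ 1) (ha : a ∈ s) (ha' : a' ∈ s)
    (hf : f a' = f a) : a = a' := by
  classical
  by_contra hne
  have h2 : ({a, a'} : Finset α) ⊆ s.filter fun x => f a = f x := by
    intro x hx
    simp only [Finset.mem_insert, Finset.mem_singleton] at hx
    rcases hx with rfl | rfl <;> simp [ha, ha', hf]
  have h3 := Finset.card_le_card h2
  rw [Finset.card_pair hne] at h3
  rw [Multiset.count_map] at h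
  have : (s.filter fun x => f a = f x).card = (s.val.filter fun x => f a = f x).card := rfl
  omega

theorem mem_mixedDiffs {n v : ℕ} {i j : Fin n} {B : Finset (Fin n × ZMod v)} {d : ZMod v} :
    d ∈ mixedDiffs i j B ↔
      ∃ x y, (i, x) ∈ B ∧ (j, y) ∈ B ∧ (i, x) ≠ (j, y) ∧ x - y = d := by
  simp only [mixedDiffs, Multiset.mem_map, Finset.mem_val, Finset.mem_filter,
    Finset.mem_offDiag]
  constructor
  · rintro ⟨⟨⟨i', x⟩, ⟨j', y⟩⟩, ⟨⟨h1, h2, h3⟩, rfl, rfl⟩, rfl⟩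
    exact ⟨x, y, h1, h2, h3, rfl⟩
  · rintro ⟨x, y, h1, h2, h3, rfl⟩
    exact ⟨((i, x), (j, y)), ⟨⟨h1, h2, h3⟩, rfl, rfl⟩, rfl⟩

/-! ### Groups and holes of the standard point set. -/

theorem holes_inter_groups_ncard {n m t : ℕ} (ht : 0 < t) (l : ℕ) (i : Fin n) :
    ({p : Fin n × ZMod (m * t) | p.2 - (l : ZMod (m * t)) ∈ holeSubgroup m t} ∩
      {p | p.1 = i}).ncard = m := by
  have : ({p : Fin n × ZMod (m * t) | p.2 - (l : ZMod (m * t)) ∈ holeSubgroup m t} ∩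
      {p | p.1 = i}) = (fun x : ZMod (m * t) => (i, x + (l : ZMod (m * t)))) '' (holeSubgroup m t : Set (ZMod (m * t))) := by
    ext ⟨j, x⟩
    simp only [Set.mem_inter_iff, Set.mem_ofPred_eq, Set.mem_image, Finset.mem_coe, Prod.mk.injEq]
    constructor
    · rintro ⟨h, rfl⟩
      exact ⟨_, h, rfl, by ring⟩
    · rintro ⟨y, h, rfl, rfl⟩
      simpa using h
  rw [this, Set.ncard_image_of_injective, Set.ncard_coe_finset, card_holeSubgroup ht]
  intro x y h
  simpa using h

theorem holes_ncard {n m t : ℕ} (ht : 0 < t) (l : ℕ) :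
    ({p : Fin n × ZMod (m * t) | p.2 - (l : ZMod (m * t)) ∈ holeSubgroup m t}).ncard = n * m := by
  have : {p : Fin n × ZMod (m * t) | p.2 - (l : ZMod (m * t)) ∈ holeSubgroup m t} =
      (fun p : Fin n × ZMod (m * t) => (p.1, p.2 + l)) ''
        (((Finset.univ : Finset (Fin n)) ×ˢ holeSubgroup m t : Finset _) : Set _) := by
    ext ⟨j, x⟩
    simp only [Set.mem_ofPred_eq, Set.mem_image, Finset.mem_coe, Finset.mem_product,
      Finset.mem_univ, true_and, Prod.mk.injEq]
    constructor
    · intro h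
      exact ⟨(j, x - l), h, rfl, by ring⟩
    · rintro ⟨⟨k, y⟩, h, rfl, rfl⟩
      simpa using h
  rw [this, Set.ncard_image_of_injective, Set.ncard_coe_finset, Finset.card_product,
    card_holeSubgroup ht, Finset.card_univ, Fintype.card_fin]
  rintro ⟨i, x⟩ ⟨j, y⟩ h
  simpa using h

theorem stdGroups_isPartition {n m t : ℕ} :
    Setoid.IsPartition (stdGroups n m t) := by
  refine ⟨?_, fun p => ⟨{q | q.1 = p.1}, ⟨⟨p.1, rfl⟩, rfl⟩, ?_⟩⟩
  · rintro ⟨i, hi⟩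
    have : ((i, 0) : Fin n × ZMod (m * t)) ∈ (∅ : Set _) := by rw [hi]; rfl
    exact this
  · rintro _ ⟨⟨i, rfl⟩, h⟩
    have h' : p.1 = i := h
    rw [h']

theorem stdGroups_ncard {n m t : ℕ} : (stdGroups n m t).ncard = n := by
  have : stdGroups n m t = (fun i : Fin n => {p : Fin n × ZMod (m * t) | p.1 = i}) '' Set.univ := by
    ext g
    simp [stdGroups, eq_comm]
  rw [this, Set.ncard_image_of_injective, Set.ncard_univ, Nat.card_eq_fintype_card,
    Fintype.card_fin]
  intro i j h
  have : ((i, 0) : Fin n × ZMod (m * t)) ∈ {p : Fin n × ZMod (m * t) | p.1 = j} := by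
    rw [← show {p : Fin n × ZMod (m * t) | p.1 = i} = {p | p.1 = j} from h]; rfl
  exact this

theorem group_ncard {n m t : ℕ} (i : Fin n) :
    ({p : Fin n × ZMod (m * t) | p.1 = i}).ncard = m * t := by
  have : {p : Fin n × ZMod (m * t) | p.1 = i} = (fun x => (i, x)) '' Set.univ := by
    ext ⟨j, x⟩
    simp [eq_comm]
  rw [this, Set.ncard_image_of_injective, Set.ncard_univ, Nat.card_zmod]
  intro x y h
  simpa using h

/-- Holes are the fibres of reduction modulo t, so a point lies in exactly the hole indexed by its
residue. -/
theorem sub_natCast_mem_holeSubgroup_iff {m t : ℕ} (hm : 0 < m) (ht : 0 < t) {x : ZMod (m * t)}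
    {l : ℕ} (hl : l < t) :
    x - l ∈ holeSubgroup m t ↔ l = (ZMod.castHom (dvd_mul_left t m) (ZMod t) x).val := by
  have : NeZero t := ⟨ht.ne'⟩
  rw [mem_holeSubgroup_iff_castHom hm ht, map_sub, map_natCast, sub_eq_zero]
  constructor
  · intro h
    rw [h, ZMod.val_natCast_of_lt hl]
  · intro h
    rw [h, ZMod.natCast_zmod_val]

theorem stdHoles_isPartition {n m t : ℕ} (hn : 0 < n) (hm : 0 < m) (ht : 0 < t) :
    Setoid.IsPartition (stdHoles n m t) := by
  have : NeZero t := ⟨ht.ne'⟩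
  refine ⟨?_, fun p => ?_⟩
  · rintro ⟨l, hl, h⟩
    have : ((⟨0, hn⟩, l) : Fin n × ZMod (m * t)) ∈ (∅ : Set _) := by
      rw [h]
      change (l : ZMod (m * t)) - l ∈ holeSubgroup m t
      rw [mem_holeSubgroup_iff_castHom hm ht, sub_self, map_zero]
    exact this
  · refine ⟨_, ⟨⟨_, ZMod.val_lt (ZMod.castHom (dvd_mul_left t m) (ZMod t) p.2), rfl⟩, ?_⟩, ?_⟩
    · exact (sub_natCast_mem_holeSubgroup_iff hm ht (ZMod.val_lt _)).2 rfl
    · rintro _ ⟨⟨l, hl, rfl⟩, h⟩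
      have := (sub_natCast_mem_holeSubgroup_iff hm ht hl).1 h
      rw [← this]

theorem stdHoles_ncard {n m t : ℕ} (hn : 0 < n) (hm : 0 < m) (ht : 0 < t) :
    (stdHoles n m t).ncard = t := by
  have h1 : stdHoles n m t = (fun l : ℕ => {p : Fin n × ZMod (m * t) |
      p.2 - (l : ZMod (m * t)) ∈ holeSubgroup m t}) '' (Finset.range t : Set ℕ) := by
    ext g
    simp [stdHoles, eq_comm]
  rw [h1, Set.InjOn.ncard_image, Set.ncard_coe_finset, Finset.card_range]
  intro l hl k hk h
  simp only [Finset.coe_range, Set.mem_Iio] at hl hk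
  have h2 : ((⟨0, hn⟩, l) : Fin n × ZMod (m * t)) ∈ {p : Fin n × ZMod (m * t) |
      p.2 - (l : ZMod (m * t)) ∈ holeSubgroup m t} := by
    change (l : ZMod (m * t)) - l ∈ holeSubgroup m t
    rw [mem_holeSubgroup_iff_castHom hm ht, sub_self, map_zero]
  have h3 := (sub_natCast_mem_holeSubgroup_iff hm ht hl).1 h2
  dsimp only at h
  rw [h] at h2
  exact h3.trans ((sub_natCast_mem_holeSubgroup_iff hm ht hk).1 h2).symm

/-! ### From difference conditions to a holey group divisible design. -/

/-- The difference conditions of a semi-cyclic HGDD imply that its development is an HGDD. -/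
theorem isHGDD_develop {k n m t : ℕ} (hn : 0 < n) (hm : 0 < m) (ht : 0 < t)
    {F : Multiset (Finset (Fin n × ZMod (m * t)))} (hk : ∀ B ∈ F, B.card = k)
    (hc : ∀ i j : Fin n, i ≠ j → ∀ d ∉ holeSubgroup m t, (F.bind (mixedDiffs i j)).count d = 1)
    (hh : ∀ i j : Fin n, i ≠ j → ∀ d ∈ holeSubgroup m t, d ∉ F.bind (mixedDiffs i j))
    (hp : ∀ i : Fin n, F.bind (mixedDiffs i i) = 0) :
    IsHGDD {k} n m t (stdGroups n m t) (stdHoles n m t) (develop F) := by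
  have : NeZero (m * t) := ⟨(Nat.mul_pos hm ht).ne'⟩
  have hinj : ∀ c : ZMod (m * t),
      Function.Injective fun p : Fin n × ZMod (m * t) => (p.1, p.2 + c) := by
    rintro c ⟨i, x⟩ ⟨j, y⟩ h
    simpa using h
  have hgrp : ∀ A ∈ F, ∀ i x y, (i, x) ∈ A → (i, y) ∈ A → x = y := by
    intro A hA i x y hx hy
    by_contra hne
    have : x - y ∈ F.bind (mixedDiffs i i) :=
      Multiset.mem_bind.2 ⟨A, hA, mem_mixedDiffs.2 ⟨x, y, hx, hy, by simpa using hne, rfl⟩⟩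
    rw [hp] at this
    exact Multiset.notMem_zero _ this
  refine
    { finite := inferInstance
      card_points := by simp [mul_assoc]
      groups_partition := stdGroups_isPartition
      groups_number := stdGroups_ncard
      group_size := ?_
      holes_partition := stdHoles_isPartition hn hm ht
      holes_number := stdHoles_ncard hn hm ht
      hole_size := ?_
      hole_inter_group := ?_
      block_size := ?_
      block_group := ?_
      block_hole := ?_
      pair_unique := ?_ }
  · rintro _ ⟨i, rfl⟩
    exact group_ncard i
  · rintro _ ⟨l, -, rfl⟩
    exact holes_ncard ht l
  · rintro _ ⟨l, -, rfl⟩ _ ⟨i, rfl⟩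
    exact holes_inter_groups_ncard ht l i
  · rintro _ ⟨A, hA, c, rfl⟩
    rw [Finset.card_image_of_injective _ (hinj c)]
    exact hk A hA
  · rintro _ ⟨A, hA, c, rfl⟩ _ ⟨i, rfl⟩ x hx y hy hxi hyi
    rw [Finset.mem_image] at hx hy
    obtain ⟨⟨i', x⟩, hx, rfl⟩ := hx
    obtain ⟨⟨j', y⟩, hy, rfl⟩ := hy
    obtain rfl : i' = i := hxi
    obtain rfl : j' = i' := hyi
    rw [hgrp A hA _ _ _ hx hy]
  · rintro _ ⟨A, hA, c, rfl⟩ _ ⟨l, -, rfl⟩ x hx y hy hxi hyi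
    rw [Finset.mem_image] at hx hy
    obtain ⟨⟨i, x⟩, hx, rfl⟩ := hx
    obtain ⟨⟨j, y⟩, hy, rfl⟩ := hy
    by_cases hij : i = j
    · subst hij
      rw [hgrp A hA _ _ _ hx hy]
    · exfalso
      refine hh i j hij (x - y) ?_ (Multiset.mem_bind.2
        ⟨A, hA, mem_mixedDiffs.2 ⟨x, y, hx, hy, by simp [hij], rfl⟩⟩)
      have h1 : x + c - l ∈ holeSubgroup m t := hxi
      have h2 : y + c - l ∈ holeSubgroup m t := hyi
      rw [mem_holeSubgroup_iff_castHom hm ht] at h1 h2 ⊢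
      rw [show x - y = (x + c - l) - (y + c - l) by ring, map_sub, h1, h2, sub_zero]
  · rintro ⟨i, x⟩ ⟨j, y⟩ - hG hH
    have hij : i ≠ j := fun h => hG _ ⟨i, rfl⟩ ⟨rfl, h.symm⟩
    -- If the difference were in the subgroup, the hole through (i, x) would also contain (j, y).
    have hd : x - y ∉ holeSubgroup m t := by
      intro hd
      have : NeZero t := ⟨ht.ne'⟩
      obtain ⟨_, ⟨⟨l, hl, rfl⟩, h⟩, -⟩ := (stdHoles_isPartition hn hm ht).2 (i, x)
      refine hH _ ⟨l, hl, rfl⟩ ⟨h, ?_⟩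
      have h1 : x - l ∈ holeSubgroup m t := h
      change y - l ∈ holeSubgroup m t
      rw [mem_holeSubgroup_iff_castHom hm ht] at h1 hd ⊢
      rw [show y - l = (x - l) - (x - y) by ring, map_sub, h1, hd, sub_zero]
    have hcd := hc i j hij _ hd
    have hmem : x - y ∈ F.bind (mixedDiffs i j) := by
      rw [← Multiset.one_le_count_iff_mem, hcd]
    obtain ⟨A, hA, hAd⟩ := Multiset.mem_bind.1 hmem
    obtain ⟨x₀, y₀, hx₀, hy₀, -, hxy₀⟩ := mem_mixedDiffs.1 hAd
    -- The base pair (x₀, y₀) has the same difference as (x, y), so the shift taking x₀ to x also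
    -- takes y₀ to y.
    refine ⟨_, ⟨⟨A, hA, x - x₀, rfl⟩, ?_, ?_⟩, ?_⟩
    · exact Finset.mem_image.2 ⟨(i, x₀), hx₀, by simp⟩
    · refine Finset.mem_image.2 ⟨(j, y₀), hy₀, ?_⟩
      rw [Prod.mk.injEq]
      refine ⟨rfl, ?_⟩
      linear_combination -hxy₀
    · rintro _ ⟨⟨A', hA', c, rfl⟩, hx, hy⟩
      rw [Finset.mem_image] at hx hy
      obtain ⟨⟨i', x₁⟩, hx₁, hx⟩ := hx
      obtain ⟨⟨j', y₁⟩, hy₁, hy⟩ := hy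
      rw [Prod.mk.injEq] at hx hy
      obtain ⟨rfl, rfl⟩ := hx
      obtain ⟨rfl, rfl⟩ := hy
      dsimp only at *
      -- Differences are unchanged by translation: multiplicity one gives first A' = A, then (x₁,
      -- y₁) = (x₀, y₀), and hence the shift c.
      have hAd' : x₁ + c - (y₁ + c) ∈ mixedDiffs i' j' A' :=
        mem_mixedDiffs.2 ⟨x₁, y₁, hx₁, hy₁, by simp [hij], by ring⟩
      obtain rfl := Multiset.eq_of_mem_of_count_bind_le_one hcd.le hA hA' hAd hAd'
      have hle := (Multiset.one_le_count_bind (f := mixedDiffs i' j') hA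
        (x₁ + c - (y₁ + c))).trans hcd.le
      have hmem' : ∀ x y, (i', x) ∈ A → (j', y) ∈ A → (((i', x), (j', y)) : _ × _) ∈
          A.offDiag.filter fun p => p.1.1 = i' ∧ p.2.1 = j' := by
        intro x y hx hy
        simp [hx, hy, hij]
      have := Finset.eq_of_count_map_le_one
        (f := fun p : (Fin n × ZMod (m * t)) × (Fin n × ZMod (m * t)) => p.1.2 - p.2.2)
        (by
          rw [add_sub_add_right_eq_sub] at hle
          exact hle) (hmem' _ _ hx₁ hy₁) (hmem' _ _ hx₀ hy₀)
        (by
          change x₀ - y₀ = x₁ - y₁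
          rw [hxy₀]; ring)
      simp only [Prod.mk.injEq, true_and] at this
      rw [this.1]
      congr 1
      ext p
      · rfl
      · congr 2; ring

/-! ### From a perfect difference family to a perfect 3-SCHGDD. -/

/-- Since 2 is invertible modulo 3 and 5, any two terms of a progression (x, y, 2y - x) determine it
and are distinct when x ≠ y. Each projection is thus an injective self-map of the finite set of
off-diagonal pairs, hence a permutation. -/
theorem map_lineTriple_eq {k : ℕ} [NeZero k] (hk : k = 3 ∨ k = 5) (i j : Fin 3) (hij : i ≠ j) :
    ((Finset.univ : Finset (ZMod k)).offDiag.val.map fun p =>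
      ((![p.1, p.2, 2 * p.2 - p.1] : Fin 3 → ZMod k) i,
        (![p.1, p.2, 2 * p.2 - p.1] : Fin 3 → ZMod k) j)) =
      (Finset.univ : Finset (ZMod k)).offDiag.val := by
  have key : ∀ (f : ZMod k × ZMod k → ZMod k × ZMod k),
      Set.InjOn f ((Finset.univ : Finset (ZMod k)).offDiag : Set _) →
      (∀ p ∈ (Finset.univ : Finset (ZMod k)).offDiag,
        f p ∈ (Finset.univ : Finset (ZMod k)).offDiag) →
      (Finset.univ : Finset (ZMod k)).offDiag.val.map f =
        (Finset.univ : Finset (ZMod k)).offDiag.val := by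
    intro f hf hm
    rw [← Finset.image_val_of_injOn hf]
    congr 1
    exact Finset.eq_of_subset_of_card_le (Finset.image_subset_iff.2 hm)
      (Finset.card_image_of_injOn hf).ge
  have h2 : ∀ x y : ZMod k, 2 * x = 2 * y → x = y := by
    rcases hk with rfl | rfl <;> decide
  apply key
  · rintro ⟨x, y⟩ - ⟨x', y'⟩ - h
    rw [Prod.mk.injEq] at h ⊢
    fin_cases i <;> fin_cases j <;> simp at hij h <;> obtain ⟨h, h'⟩ := h
    · exact ⟨h, h'⟩
    · exact ⟨h, h2 _ _ (by linear_combination h' + h)⟩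
    · exact ⟨h', h⟩
    · exact ⟨by linear_combination 2 * h - h', h⟩
    · exact ⟨h', h2 _ _ (by linear_combination h' + h)⟩
    · exact ⟨by linear_combination 2 * h' - h, h'⟩
  · rintro ⟨x, y⟩ h
    simp only [Finset.mem_offDiag, Finset.mem_univ, true_and] at h ⊢
    fin_cases i <;> fin_cases j <;> simp at hij ⊢ <;> intro e <;> apply h
    · exact e
    · exact h2 _ _ (by linear_combination e)
    · exact e.symm
    · linear_combination e
    · exact h2 _ _ (by linear_combination -e)
    · linear_combination -e

/-- A set of size 3 or 5 carries an idempotent self-orthogonal system of triples: the `3`-HGDD of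
type `(3, 1^k)`. -/
theorem exists_transversal_triples {α : Type*} [DecidableEq α] (B : Finset α)
    (hB : B.card ∈ ({3, 5} : Set ℕ)) :
    ∃ T : Multiset (Fin 3 → α), ∀ i j : Fin 3, i ≠ j →
      T.map (fun τ => (τ i, τ j)) = B.offDiag.val := by
  set k := B.card with hk
  have : NeZero k := ⟨by rintro h; rw [h] at hB; simp at hB⟩
  have e : ZMod k ≃ B := Fintype.equivOfCardEq (by simp [hk])
  let f : ZMod k → α := fun x => e x
  have hf : Function.Injective f := fun x y h => e.injective (Subtype.ext h)
  refine ⟨(Finset.univ : Finset (ZMod k)).offDiag.val.map fun p =>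
    f ∘ ![p.1, p.2, 2 * p.2 - p.1], fun i j hij => ?_⟩
  have h1 := congrArg (Multiset.map (Prod.map f f)) (map_lineTriple_eq (by simpa using hB) i j hij)
  rw [Multiset.map_map] at h1 ⊢
  refine h1.trans ?_
  rw [← Finset.image_val_of_injOn (hf.prodMap hf).injOn]
  congr 1
  ext ⟨x, y⟩
  simp only [Finset.mem_image, Finset.mem_offDiag, Finset.mem_univ, true_and, Prod.exists,
    Prod.map_apply, Prod.mk.injEq, ne_eq]
  constructor
  · rintro ⟨a, b, hab, rfl, rfl⟩
    exact ⟨(e a).2, (e b).2, fun h => hab (hf h)⟩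
  · rintro ⟨hx, hy, hxy⟩
    refine ⟨e.symm ⟨x, hx⟩, e.symm ⟨y, hy⟩, fun h => hxy ?_, by simp [f], by simp [f]⟩
    simpa using h

/-- The base block `{(i, τ i - c) : i ∈ I_n}`. -/
def tripleBlock {n v : ℕ} (τ : Fin n → ZMod v) (c : ZMod v) : Finset (Fin n × ZMod v) :=
  Finset.univ.image fun i => (i, τ i - c)

theorem mem_tripleBlock {n v : ℕ} {τ : Fin n → ZMod v} {c : ZMod v} {p : Fin n × ZMod v} :
    p ∈ tripleBlock τ c ↔ p.2 = τ p.1 - c := by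
  obtain ⟨i, x⟩ := p
  simp [tripleBlock, eq_comm]

theorem card_tripleBlock {n v : ℕ} (τ : Fin n → ZMod v) (c : ZMod v) :
    (tripleBlock τ c).card = n := by
  rw [tripleBlock, Finset.card_image_of_injective, Finset.card_univ, Fintype.card_fin]
  intro i j h
  exact (Prod.mk.inj h).1

theorem mixedDiffs_tripleBlock {n v : ℕ} (τ : Fin n → ZMod v) (c : ZMod v) {i j : Fin n}
    (hij : i ≠ j) : mixedDiffs i j (tripleBlock τ c) = {τ i - τ j} := by
  have : ((tripleBlock τ c).offDiag.filter fun p => p.1.1 = i ∧ p.2.1 = j) =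
      {((i, τ i - c), (j, τ j - c))} := by
    ext ⟨⟨i', x⟩, ⟨j', y⟩⟩
    simp only [Finset.mem_filter, Finset.mem_offDiag, mem_tripleBlock, Finset.mem_singleton,
      Prod.mk.injEq, ne_eq]
    constructor
    · rintro ⟨⟨rfl, rfl, -⟩, rfl, rfl⟩
      exact ⟨⟨rfl, rfl⟩, rfl, rfl⟩
    · rintro ⟨⟨rfl, rfl⟩, rfl, rfl⟩
      exact ⟨⟨rfl, rfl, fun h => hij h.1⟩, rfl, rfl⟩
  rw [mixedDiffs, this]
  simp

theorem mixedDiffs_self_tripleBlock {n v : ℕ} (τ : Fin n → ZMod v) (c : ZMod v) (i : Fin n) :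
    mixedDiffs i i (tripleBlock τ c) = 0 := by
  refine Multiset.eq_zero_of_forall_notMem fun d hd => ?_
  obtain ⟨x, y, hx, hy, hne, -⟩ := mem_mixedDiffs.1 hd
  rw [mem_tripleBlock] at hx hy
  exact hne (by rw [Prod.mk.injEq]; exact ⟨rfl, hx.trans hy.symm⟩)

/-- A perfect difference family with block sizes 3 and 5 yields a perfect 3-SCHGDD. -/
theorem IsPDF.exists_isPerfectSCHGDD {g t : ℕ} (hg : 0 < g) (ht : 0 < t)
    {F : Multiset (Finset (ZMod (g * t)))} (hF : IsPDF g t {3, 5} F) :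
    ∃ F' : Multiset (Finset (Fin 3 × ZMod (g * t))), IsPerfectSCHGDD 3 3 g t F' := by
  have : NeZero (g * t) := ⟨(Nat.mul_pos hg ht).ne'⟩
  -- Sets of other sizes receive the empty system, so that the choice is total.
  have hT' : ∀ B : Finset (ZMod (g * t)), ∃ T : Multiset (Fin 3 → ZMod (g * t)),
      B.card ∈ ({3, 5} : Set ℕ) → ∀ i j : Fin 3, i ≠ j →
        T.map (fun τ => (τ i, τ j)) = B.offDiag.val := by
    intro B
    by_cases h : B.card ∈ ({3, 5} : Set ℕ)
    · obtain ⟨T, hT⟩ := exists_transversal_triples B h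
      exact ⟨T, fun _ => hT⟩
    · exact ⟨0, fun h' => absurd h' h⟩
  choose T hT using hT'
  -- Subtracting the coordinate with least representative involves no wraparound: the others become
  -- integer differences between 0 and gt/2.
  have hmin : ∀ τ : Fin 3 → ZMod (g * t), ∃ m, ∀ i, (τ m).val ≤ (τ i).val := fun τ =>
    Finite.exists_min fun i => (τ i).val
  choose μ hμ using hmin
  have hbind : ∀ i j : Fin 3, i ≠ j →
      ((F.bind T).map fun τ => tripleBlock τ (τ (μ τ))).bind (mixedDiffs i j) =
        F.bind blockDiffs := by
    intro i j hij
    rw [Multiset.bind_map]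
    simp_rw [mixedDiffs_tripleBlock _ _ hij, Multiset.bind_singleton]
    rw [Multiset.map_bind]
    refine Multiset.bind_congr fun B hB => ?_
    rw [blockDiffs, ← hT B (hF.isCDF.card_mem B hB) i j hij, Multiset.map_map]
    rfl
  have hcard : ∀ B ∈ (F.bind T).map fun τ => tripleBlock τ (τ (μ τ)), B.card = 3 := by
    intro B hB
    obtain ⟨τ, -, rfl⟩ := Multiset.mem_map.1 hB
    exact card_tripleBlock _ _
  have hcount : ∀ i j : Fin 3, i ≠ j → ∀ d ∉ holeSubgroup g t,
      (((F.bind T).map fun τ => tripleBlock τ (τ (μ τ))).bind (mixedDiffs i j)).count d = 1 := by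
    intro i j hij d hd
    rw [hbind i j hij]
    exact hF.isCDF.count_diff d hd
  have hhole : ∀ i j : Fin 3, i ≠ j → ∀ d ∈ holeSubgroup g t,
      d ∉ ((F.bind T).map fun τ => tripleBlock τ (τ (μ τ))).bind (mixedDiffs i j) := by
    intro i j hij d hd
    rw [hbind i j hij]
    exact hF.isCDF.hole_diff d hd
  have hpure : ∀ i : Fin 3,
      ((F.bind T).map fun τ => tripleBlock τ (τ (μ τ))).bind (mixedDiffs i i) = 0 := by
    intro i
    rw [Multiset.bind_map]
    simp_rw [mixedDiffs_self_tripleBlock]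
    exact Multiset.bind_zero _
  refine ⟨(F.bind T).map fun τ => tripleBlock τ (τ (μ τ)),
    ⟨hcard, hcount, hhole, hpure,
      isHGDD_develop (by norm_num) hg ht hcard hcount hhole hpure⟩, ?_⟩
  intro A hA
  obtain ⟨τ, hτ, rfl⟩ := Multiset.mem_map.1 hA
  obtain ⟨B, hB, hτB⟩ := Multiset.mem_bind.1 hτ
  have hpair : ∀ i j, i ≠ j → (τ i, τ j) ∈ B.offDiag := by
    intro i j hij
    rw [← Finset.mem_val, ← hT B (hF.isCDF.card_mem B hB) i j hij]
    exact Multiset.mem_map_of_mem _ hτB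
  refine ⟨(μ τ, 0), mem_tripleBlock.2 (by simp), rfl, ?_⟩
  rintro ⟨i, x⟩ hx hne
  obtain rfl : x = τ i - τ (μ τ) := mem_tripleBlock.1 hx
  have hi : i ≠ μ τ := by
    rintro h
    apply hne
    rw [← h, sub_self]
  have hm := Finset.mem_offDiag.1 (hpair _ _ hi)
  have hval : (τ i - τ (μ τ)).val = (τ i).val - (τ (μ τ)).val := ZMod.val_sub (hμ τ i)
  have hle : (τ i).val ≤ g * t / 2 := by
    by_cases h0 : τ i = 0
    · rw [h0, ZMod.val_zero]; exact Nat.zero_le _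
    · obtain ⟨a, ha, -, hax⟩ := hF.ele_subset B hB _ hm.1 h0
      have hax' : τ i = a := hax
      rw [hax', ZMod.val_natCast_of_lt]
      · exact ha
      · have := Nat.mul_pos hg ht
        omega
  refine ⟨(τ i).val - (τ (μ τ)).val, by omega, ?_, ?_⟩
  -- The new coordinate is itself a difference of B, so it avoids the hole subgroup.
  · rw [← hval, ← mem_holeSubgroup hg ht]
    intro hd
    exact hF.isCDF.hole_diff _ hd (Multiset.mem_bind.2 ⟨B, hB, Multiset.mem_map.2
      ⟨_, hpair _ _ hi, rfl⟩⟩)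
  · rw [← hval, ZMod.natCast_zmod_val]

/-! ### Reduction to positive differences of integer sets. -/

/-- The list of positive differences of a set of natural numbers. -/
def posDiffs (B : Finset ℕ) : Multiset ℕ :=
  (B.offDiag.filter fun p => p.2 < p.1).val.map fun p => p.1 - p.2

theorem mem_posDiffs {B : Finset ℕ} {d : ℕ} :
    d ∈ posDiffs B ↔ 0 < d ∧ ∃ y ∈ B, y + d ∈ B := by
  simp only [posDiffs, Multiset.mem_map, Finset.mem_val, Finset.mem_filter, Finset.mem_offDiag]
  constructor
  · rintro ⟨⟨x, y⟩, ⟨⟨hx, hy, -⟩, hlt⟩, rfl⟩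
    dsimp only at *
    refine ⟨by omega, y, hy, ?_⟩
    rwa [Nat.add_sub_cancel' hlt.le]
  · rintro ⟨hd, y, hy, hx⟩
    exact ⟨(y + d, y), ⟨⟨hx, hy, by dsimp only; omega⟩, by dsimp only; omega⟩, by simp⟩

theorem filter_not_lt_offDiag (B : Finset ℕ) :
    (B.offDiag.filter fun p => ¬ p.2 < p.1) =
      (B.offDiag.filter fun p => p.2 < p.1).map (Equiv.prodComm ℕ ℕ).toEmbedding := by
  ext ⟨x, y⟩
  simp only [Finset.mem_filter, Finset.mem_offDiag, Finset.mem_map_equiv, Equiv.prodComm_symm,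
    Equiv.prodComm_apply, Prod.swap_prod_mk]
  constructor
  · rintro ⟨⟨hx, hy, hne⟩, hlt⟩
    exact ⟨⟨hy, hx, hne.symm⟩, by omega⟩
  · rintro ⟨⟨hy, hx, hne⟩, hlt⟩
    exact ⟨⟨hx, hy, hne.symm⟩, by omega⟩

theorem card_posDiffs (B : Finset ℕ) : (posDiffs B).card = B.card.choose 2 := by
  have h1 := Finset.card_filter_add_card_filter_not (s := B.offDiag) fun p : ℕ × ℕ => p.2 < p.1
  rw [filter_not_lt_offDiag, Finset.card_map, Finset.offDiag_card] at h1
  rw [posDiffs, Multiset.card_map, Finset.card_val, Nat.choose_two_right, Nat.mul_sub, mul_one]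
  omega

/-- Reduction modulo v is injective on B, and ordered pairs split by orientation: swapping a pair
negates its difference. -/
theorem blockDiffs_image_natCast {v : ℕ} {B : Finset ℕ} (hB : ∀ x ∈ B, x < v) :
    blockDiffs (B.image (Nat.cast : ℕ → ZMod v)) =
      (posDiffs B).map (Nat.cast : ℕ → ZMod v) +
        (posDiffs B).map fun d : ℕ => -(d : ZMod v) := by
  have hinj : Set.InjOn (Nat.cast : ℕ → ZMod v) B := by
    intro x hx y hy h
    rw [ZMod.natCast_eq_natCast_iff'] at h
    rwa [Nat.mod_eq_of_lt (hB x hx), Nat.mod_eq_of_lt (hB y hy)] at h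
  have hoff : (B.image (Nat.cast : ℕ → ZMod v)).offDiag =
      B.offDiag.image (Prod.map Nat.cast Nat.cast) := by
    ext ⟨x, y⟩
    simp only [Finset.mem_offDiag, Finset.mem_image, Prod.exists, Prod.map_apply, Prod.mk.injEq]
    constructor
    · rintro ⟨⟨a, ha, rfl⟩, ⟨b, hb, rfl⟩, hne⟩
      exact ⟨a, b, ⟨ha, hb, fun h => hne (by rw [h])⟩, rfl, rfl⟩
    · rintro ⟨a, b, ⟨ha, hb, hne⟩, rfl, rfl⟩
      exact ⟨⟨a, ha, rfl⟩, ⟨b, hb, rfl⟩, fun h => hne (hinj ha hb h)⟩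
  have hsplit : B.offDiag.val = (B.offDiag.filter fun p => p.2 < p.1).val +
      (B.offDiag.filter fun p => ¬ p.2 < p.1).val := by
    rw [Finset.filter_val, Finset.filter_val, Multiset.filter_add_not]
  rw [blockDiffs, hoff, Finset.image_val_of_injOn, Multiset.map_map, hsplit, Multiset.map_add,
    filter_not_lt_offDiag, Finset.map_val, Multiset.map_map, posDiffs, Multiset.map_map,
    Multiset.map_map]
  · congr 1
    · refine Multiset.map_congr rfl ?_
      rintro ⟨x, y⟩ h
      have h' : y < x := (Finset.mem_filter.1 h).2
      simp [Nat.cast_sub h'.le]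
    · refine Multiset.map_congr rfl ?_
      rintro ⟨x, y⟩ h
      have h' : y < x := (Finset.mem_filter.1 h).2
      simp [Nat.cast_sub h'.le]
  · rintro ⟨x, y⟩ h ⟨x', y'⟩ h' e
    simp only [Finset.coe_offDiag, Set.mem_offDiag, Finset.mem_coe] at h h'
    simp only [Prod.map_apply, Prod.mk.injEq] at e
    rw [Prod.mk.injEq]
    exact ⟨hinj h.1 h'.1 e.1, hinj h.2.1 h'.2.1 e.2⟩

/-- Integer sets of sizes 3 and 5 containing `0` whose positive differences are exactly
`1, …, 2t - 1` without `t` form a `(4t, 4, {3, 5}, 1)`-perfect difference family. -/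
theorem isPDF_of_bind_posDiffs {t : ℕ} (ht : 0 < t) {L : Multiset (Finset ℕ)}
    (h0 : ∀ B ∈ L, 0 ∈ B) (hcard : ∀ B ∈ L, B.card ∈ ({3, 5} : Set ℕ))
    (hL : L.bind posDiffs = ((Finset.Ioo 0 (2 * t)).erase t).val) :
    IsPDF 4 t {3, 5} (L.map fun B => B.image (Nat.cast : ℕ → ZMod (4 * t))) := by
  have : NeZero (4 * t) := ⟨by omega⟩
  have hE : ∀ B ∈ L, ∀ x ∈ B, x ≠ 0 → x ∈ (Finset.Ioo 0 (2 * t)).erase t := by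
    intro B hB x hx hx0
    rw [← Finset.mem_val, ← hL]
    exact Multiset.mem_bind.2 ⟨B, hB, mem_posDiffs.2
      ⟨Nat.pos_of_ne_zero hx0, 0, h0 B hB, by rwa [zero_add]⟩⟩
  have hlt : ∀ B ∈ L, ∀ x ∈ B, x < 4 * t := by
    intro B hB x hx
    by_cases hx0 : x = 0
    · omega
    · have := hE B hB x hx hx0
      simp only [Finset.mem_erase, Finset.mem_Ioo] at this
      omega
  have hndvd : ∀ d ∈ (Finset.Ioo 0 (2 * t)).erase t, ¬ t ∣ d := by
    rintro _ hd ⟨k, rfl⟩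
    simp only [Finset.mem_erase, Finset.mem_Ioo] at hd
    obtain ⟨h1, h2, h3⟩ := hd
    have hk : k < 2 := Nat.lt_of_mul_lt_mul_left (a := t) (by omega)
    interval_cases k <;> omega
  have hdiffs : (L.map fun B => B.image (Nat.cast : ℕ → ZMod (4 * t))).bind blockDiffs =
      ((Finset.Ioo 0 (2 * t)).erase t).val.map (Nat.cast : ℕ → ZMod (4 * t)) +
        ((Finset.Ioo 0 (2 * t)).erase t).val.map fun d : ℕ => -(d : ZMod (4 * t)) := by
    rw [Multiset.bind_map, ← hL, Multiset.map_bind, Multiset.map_bind, ← Multiset.bind_add]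
    exact Multiset.bind_congr fun B hB => blockDiffs_image_natCast (hlt B hB)
  have hcast : ∀ x y : ℕ, x < 4 * t → y < 4 * t →
      (x : ZMod (4 * t)) = y → x = y := by
    intro x y hx hy h
    rw [ZMod.natCast_eq_natCast_iff'] at h
    rwa [Nat.mod_eq_of_lt hx, Nat.mod_eq_of_lt hy] at h
  refine ⟨⟨?_, ?_, ?_⟩, ?_, ?_⟩
  · intro A hA
    obtain ⟨B, hB, rfl⟩ := Multiset.mem_map.1 hA
    rw [Finset.card_image_of_injOn]
    · exact hcard B hB
    · intro x hx y hy h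
      exact hcast x y (hlt B hB x hx) (hlt B hB y hy) h
  · intro d hd
    rw [hdiffs]
    refine Multiset.count_eq_one_of_mem ?_ ?_
    · rw [Multiset.nodup_add]
      refine ⟨Multiset.Nodup.map_on ?_ (Finset.nodup _),
        Multiset.Nodup.map_on ?_ (Finset.nodup _), ?_⟩
      · intro x hx y hy h
        simp only [Finset.mem_val, Finset.mem_erase, Finset.mem_Ioo] at hx hy
        exact hcast x y (by omega) (by omega) h
      · intro x hx y hy h
        simp only [Finset.mem_val, Finset.mem_erase, Finset.mem_Ioo] at hx hy
        exact hcast x y (by omega) (by omega) (neg_injective h)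
      -- A common value would give x = -y modulo 4t, but 0 < x + y < 4t.
      · rw [Multiset.disjoint_left]
        intro a ha ha'
        obtain ⟨x, hx, rfl⟩ := Multiset.mem_map.1 ha
        obtain ⟨y, hy, h⟩ := Multiset.mem_map.1 ha'
        simp only [Finset.mem_val, Finset.mem_erase, Finset.mem_Ioo] at hx hy
        have h1 : ((x + y : ℕ) : ZMod (4 * t)) = (0 : ℕ) := by
          push_cast
          linear_combination -h
        have := hcast _ _ (by omega) (by omega) h1
        omega
    · rw [mem_holeSubgroup (by norm_num) ht] at hd
      have hv := ZMod.val_lt d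
      have hne : d.val ≠ 0 := fun h => hd (h ▸ dvd_zero t)
      have hne1 : d.val ≠ t := fun h => hd (dvd_of_eq h.symm)
      have hne2 : d.val ≠ 2 * t := fun h => hd (h ▸ dvd_mul_left _ _)
      have hne3 : d.val ≠ 3 * t := fun h => hd (h ▸ dvd_mul_left _ _)
      rw [Multiset.mem_add, Multiset.mem_map, Multiset.mem_map]
      -- Residues in the lower half are positive differences; those in the upper half are negatives
      -- of them.
      by_cases h : d.val < 2 * t
      · refine Or.inl ⟨d.val, ?_, ZMod.natCast_zmod_val d⟩
        simp only [Finset.mem_val, Finset.mem_erase, Finset.mem_Ioo]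
        omega
      · refine Or.inr ⟨4 * t - d.val, ?_, ?_⟩
        · simp only [Finset.mem_val, Finset.mem_erase, Finset.mem_Ioo]
          omega
        · rw [Nat.cast_sub hv.le, ZMod.natCast_self, ZMod.natCast_zmod_val]
          ring
  · intro d hd
    rw [hdiffs, Multiset.mem_add, Multiset.mem_map, Multiset.mem_map]
    rintro (⟨x, hx, rfl⟩ | ⟨x, hx, rfl⟩)
    · exact hndvd x hx ((natCast_mem_holeSubgroup (by norm_num) ht x).1 hd)
    · refine hndvd x hx ((natCast_mem_holeSubgroup (m := 4) (by norm_num) ht x).1 ?_)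
      rw [mem_holeSubgroup_iff_castHom (by norm_num) ht] at hd ⊢
      rwa [map_neg, neg_eq_zero] at hd
  · intro A hA
    obtain ⟨B, hB, rfl⟩ := Multiset.mem_map.1 hA
    exact Finset.mem_image.2 ⟨0, h0 B hB, Nat.cast_zero⟩
  · intro A hA x hx hx0
    obtain ⟨B, hB, rfl⟩ := Multiset.mem_map.1 hA
    obtain ⟨a, ha, rfl⟩ := Finset.mem_image.1 hx
    have haE := hE B hB a ha (by rintro rfl; simp at hx0)
    refine ⟨a, ?_, hndvd a haE, rfl⟩
    simp only [Finset.mem_erase, Finset.mem_Ioo] at haE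
    omega

/-- `T` lists the nonzero marks of blocks `{0, a, b}` and `R` those of blocks `{0, a, b, c, d}`; if
there are as many differences as elements of `{1, …, 2t - 1} \ {t}` and each of these elements is a
difference, a perfect difference family results. -/
theorem exists_isPDF_of_lists (t : ℕ) (ht : 0 < t) (T : List (ℕ × ℕ)) (R : List (ℕ × ℕ × ℕ × ℕ))
    (hT : ∀ p ∈ T, 0 < p.1 ∧ p.1 < p.2)
    (hR : ∀ r ∈ R, 0 < r.1 ∧ r.1 < r.2.1 ∧ r.2.1 < r.2.2.1 ∧ r.2.2.1 < r.2.2.2)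
    (hlen : 3 * T.length + 10 * R.length = 2 * t - 2)
    (hcov : ∀ d < 2 * t, 0 < d → d ≠ t →
      ¬ ((∀ p ∈ T, d ≠ p.1 ∧ d ≠ p.2 ∧ p.1 + d ≠ p.2) ∧
        ∀ r ∈ R, d ≠ r.1 ∧ d ≠ r.2.1 ∧ d ≠ r.2.2.1 ∧ d ≠ r.2.2.2 ∧
          r.1 + d ≠ r.2.1 ∧ r.1 + d ≠ r.2.2.1 ∧ r.1 + d ≠ r.2.2.2 ∧
          r.2.1 + d ≠ r.2.2.1 ∧ r.2.1 + d ≠ r.2.2.2 ∧ r.2.2.1 + d ≠ r.2.2.2)) :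
    ∃ F : Multiset (Finset (ZMod (4 * t))), IsPDF 4 t {3, 5} F := by
  let L : Multiset (Finset ℕ) := (T.map fun p => ({0, p.1, p.2} : Finset ℕ)) +
    (R.map fun r => ({0, r.1, r.2.1, r.2.2.1, r.2.2.2} : Finset ℕ))
  have hmem : ∀ B, B ∈ L ↔ (∃ p ∈ T, ({0, p.1, p.2} : Finset ℕ) = B) ∨
      ∃ r ∈ R, ({0, r.1, r.2.1, r.2.2.1, r.2.2.2} : Finset ℕ) = B := by
    intro B
    rw [Multiset.mem_add, Multiset.mem_coe, Multiset.mem_coe, List.mem_map, List.mem_map]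
  have c3 : ∀ p ∈ T, ({0, p.1, p.2} : Finset ℕ).card = 3 := by
    intro p hp
    obtain ⟨h1, h2⟩ := hT p hp
    rw [Finset.card_eq_three]
    exact ⟨0, p.1, p.2, by omega, by omega, by omega, rfl⟩
  have c5 : ∀ r ∈ R, ({0, r.1, r.2.1, r.2.2.1, r.2.2.2} : Finset ℕ).card = 5 := by
    intro r hr
    obtain ⟨h1, h2, h3, h4⟩ := hR r hr
    repeat rw [Finset.card_insert_of_notMem
      (by simp only [Finset.mem_insert, Finset.mem_singleton]; omega)]
    rw [Finset.card_singleton]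
  have hcardL : (L.bind posDiffs).card = 2 * t - 2 := by
    rw [Multiset.card_bind, ← hlen]
    have e3 : (T.map fun p => ({0, p.1, p.2} : Finset ℕ)).map
        (Multiset.card ∘ posDiffs) = List.replicate T.length 3 := by
      rw [List.map_map, List.eq_replicate_iff, List.length_map]
      refine ⟨rfl, fun b hb => ?_⟩
      obtain ⟨p, hp, rfl⟩ := List.mem_map.1 hb
      simp only [Function.comp_apply, card_posDiffs, c3 p hp]
      rfl
    have e5 : (R.map fun r => ({0, r.1, r.2.1, r.2.2.1, r.2.2.2} : Finset ℕ)).map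
        (Multiset.card ∘ posDiffs) = List.replicate R.length 10 := by
      rw [List.map_map, List.eq_replicate_iff, List.length_map]
      refine ⟨rfl, fun b hb => ?_⟩
      obtain ⟨r, hr, rfl⟩ := List.mem_map.1 hb
      simp only [Function.comp_apply, card_posDiffs, c5 r hr]
      rfl
    rw [Multiset.map_add, Multiset.sum_add, Multiset.map_coe, Multiset.map_coe, e3, e5,
      Multiset.sum_coe, Multiset.sum_coe, List.sum_replicate, List.sum_replicate, smul_eq_mul,
      smul_eq_mul, mul_comm 3, mul_comm 10]
  refine ⟨_, isPDF_of_bind_posDiffs ht (L := L) ?_ ?_ ?_⟩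
  · intro B hB
    rcases (hmem B).1 hB with ⟨p, -, rfl⟩ | ⟨r, -, rfl⟩ <;> exact Finset.mem_insert_self _ _
  · intro B hB
    rcases (hmem B).1 hB with ⟨p, hp, rfl⟩ | ⟨r, hr, rfl⟩
    · exact Or.inl (c3 p hp)
    · exact Or.inr (c5 r hr)
  · symm
    -- The target has no repetitions, so coverage gives an inclusion of multisets, and equal
    -- cardinality makes it an equality. Disjointness of the differences never has to be checked.
    refine Multiset.eq_of_le_of_card_le ((Multiset.le_iff_subset (Finset.nodup _)).2 ?_) ?_
    · intro d hd
      simp only [Finset.mem_val, Finset.mem_erase, Finset.mem_Ioo] at hd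
      by_contra hcon
      have hno : ∀ B ∈ L, ∀ x ∈ B, ∀ y ∈ B, x + d ≠ y := by
        rintro B hB x hx _ hy rfl
        exact hcon (Multiset.mem_bind.2 ⟨B, hB, mem_posDiffs.2 ⟨hd.2.1, x, hx, hy⟩⟩)
      refine hcov d hd.2.2 hd.2.1 hd.1 ⟨fun p hp => ?_, fun r hr => ?_⟩
      · have h := hno _ ((hmem _).2 (Or.inl ⟨p, hp, rfl⟩))
        have h1 := h 0 (by simp) p.1 (by simp)
        have h2 := h 0 (by simp) p.2 (by simp)
        rw [zero_add] at h1 h2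
        exact ⟨h1, h2, h p.1 (by simp) p.2 (by simp)⟩
      · have h := hno _ ((hmem _).2 (Or.inr ⟨r, hr, rfl⟩))
        have h1 := h 0 (by simp) r.1 (by simp)
        have h2 := h 0 (by simp) r.2.1 (by simp)
        have h3 := h 0 (by simp) r.2.2.1 (by simp)
        have h4 := h 0 (by simp) r.2.2.2 (by simp)
        rw [zero_add] at h1 h2 h3 h4
        exact ⟨h1, h2, h3, h4, h _ (by simp) _ (by simp), h _ (by simp) _ (by simp),
          h _ (by simp) _ (by simp), h _ (by simp) _ (by simp), h _ (by simp) _ (by simp),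
          h _ (by simp) _ (by simp)⟩
    · rw [hcardL, Finset.card_val]
      by_cases h1 : t = 1
      · subst h1; simp
      · rw [Finset.card_erase_of_mem (Finset.mem_Ioo.2 (by omega)), Nat.card_Ioo]
        omega

/-! ### The three infinite families. -/

/-- The triples {0, a + 2i, c + i} with i < n produce one parity class of [a, a + 2n), the interval
[c, c + n), and, descending, c - a - i. The conclusion says that d misses all three, as linear facts
without the quantifier over i. -/
theorem ne_of_forall_range {d n a c : ℕ}
    (h : ∀ i < n, d ≠ a + 2 * i ∧ d ≠ c + i ∧ a + 2 * i + d ≠ c + i) :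
    (a ≤ d → d < a + 2 * n → (d + a) % 2 = 1) ∧ (c ≤ d → c + n ≤ d) ∧
      (d + a ≤ c → d + a + n ≤ c) := by
  refine ⟨fun h1 h2 => ?_, fun h1 => ?_, fun h1 => ?_⟩
  · have := h ((d - a) / 2) (by omega)
    omega
  · have := h (d - c)
    omega
  · have := h (c - a - d)
    omega

/-- The first run gives the even values from 6 to 4s - 2, the other two give odd values on either
side of 2s. Their second marks and descending differences fill long intervals above 4s; the last
eight blocks fill what remains. At s = 5 the third run is empty. -/
theorem exists_isPDF_six_mul (s : ℕ) (hs : 5 ≤ s) :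
    ∃ F : Multiset (Finset (ZMod (4 * (6 * s)))), IsPDF 4 (6 * s) {3, 5} F := by
  refine exists_isPDF_of_lists (6 * s) (by omega)
    ((List.range (2 * s - 3)).map (fun i => (6 + 2 * i, 10 * s + i)) ++
      (List.range (s - 3)).map (fun i => (2 * s + 1 + 2 * i, 7 * s + i)) ++
      (List.range (s - 5)).map (fun i => (7 + 2 * i, 6 * s + 3 + i)) ++
      [(2, 12 * s - 1), (3, 10 * s - 2), (5, 4 * s + 2), (2 * s - 3, 7 * s - 2),
      (2 * s - 1, 7 * s - 1), (4 * s, 10 * s - 1), (4 * s + 1, 12 * s - 2)])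
    [(4 * s - 5, 4 * s - 1, 10 * s - 4, 10 * s - 3)] ?_ ?_ ?_ ?_
  · simp only [List.forall_mem_append, List.forall_mem_cons, List.forall_mem_map, List.mem_range,
      List.not_mem_nil, IsEmpty.forall_iff, implies_true, and_true]
    refine ⟨⟨⟨fun i hi => ?_, fun i hi => ?_⟩, fun i hi => ?_⟩, ?_⟩ <;> omega
  · simp only [List.forall_mem_cons, List.not_mem_nil, IsEmpty.forall_iff, implies_true, and_true]
    omega
  · simp only [List.length_append, List.length_map, List.length_range, List.length_cons,
      List.length_nil]
    omega
  · intro d hd hd0 hdt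
    simp only [List.forall_mem_append, List.forall_mem_cons, List.forall_mem_map, List.mem_range,
      List.not_mem_nil, IsEmpty.forall_iff, implies_true, and_true]
    rintro ⟨⟨⟨⟨h1, h2⟩, h3⟩, ⟨e0a, e0b, e0c⟩, ⟨e1a, e1b, e1c⟩,
      ⟨e2a, e2b, e2c⟩, ⟨e3a, e3b, e3c⟩, ⟨e4a, e4b, e4c⟩, ⟨e5a,
      e5b, e5c⟩, ⟨e6a, e6b, e6c⟩⟩, ⟨r0a, r0b, r0c, r0d, r0e,
      r0f, r0g, r0h, r0i, r0j⟩⟩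
    obtain ⟨f1a, f1b, f1c⟩ := ne_of_forall_range h1
    obtain ⟨f2a, f2b, f2c⟩ := ne_of_forall_range h2
    obtain ⟨f3a, f3b, f3c⟩ := ne_of_forall_range h3
    -- Suppose d is missed. The range is cut at the ends of the runs; on each segment the runs and
    -- sporadic differences kept as hypotheses, together with d ≠ t where needed, exclude every
    -- value.
    rcases lt_or_ge d 6 with u0 | k0
    · clear * - hs hd0 u0 r0j e0a e1a r0e e2a
      omega
    rcases lt_or_ge d (2 * s - 3) with u1 | k1
    · clear * - hs k0 u1 f1a f3a
      omega
    rcases lt_or_ge d (2 * s) with u2 | k2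
    · clear * - hs k1 u2 f1a e3a e4a
      omega
    rcases lt_or_ge d (4 * s - 5) with u3 | k3
    · clear * - hs k2 u3 f1a f2a
      omega
    rcases lt_or_ge d (4 * s + 3) with u4 | k4
    · clear * - hs k3 u4 f1a r0a e2c r0b e5a e6a e2b
      omega
    rcases lt_or_ge d (5 * s) with u5 | k5
    · clear * - hs k4 u5 f2c
      omega
    rcases lt_or_ge d (5 * s + 2) with u6 | k6
    · clear * - hs k5 u6 e4c e3c
      omega
    rcases lt_or_ge d (6 * s - 3) with u7 | k7
    · clear * - hs k6 u7 f3c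
      omega
    rcases lt_or_ge d (6 * s + 3) with u8 | k8
    · clear * - hs k7 u8 r0h r0i e5c hdt r0f r0g
      omega
    rcases lt_or_ge d (7 * s - 2) with u9 | k9
    · clear * - hs k8 u9 f3b
      omega
    rcases lt_or_ge d (7 * s) with u10 | k10
    · clear * - hs k9 u10 e3b e4b
      omega
    rcases lt_or_ge d (8 * s - 3) with u11 | k11
    · clear * - hs k10 u11 f2b
      omega
    rcases lt_or_ge d (8 * s - 2) with u12 | k12
    · clear * - hs k11 u12 e6c
      omega
    rcases lt_or_ge d (10 * s - 5) with u13 | k13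
    · clear * - hs k12 u13 f1c
      omega
    rcases lt_or_ge d (10 * s) with u14 | k14
    · clear * - hs k13 u14 e1c r0c r0d e1b e5b
      omega
    rcases lt_or_ge d (12 * s - 3) with u15 | k15
    · clear * - hs k14 u15 f1b
      omega
    clear * - hs k15 hd e0c e6b e0b
    omega

/-- The same pattern with two quintuples, as 2t - 2 ≡ 2 (mod 3). The second run has length s - 7,
whence the bound on s. -/
theorem exists_isPDF_six_mul_add_two (s : ℕ) (hs : 7 ≤ s) :
    ∃ F : Multiset (Finset (ZMod (4 * (6 * s + 2)))), IsPDF 4 (6 * s + 2) {3, 5} F := by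
  refine exists_isPDF_of_lists (6 * s + 2) (by omega)
    ((List.range (2 * s - 4)).map (fun i => (6 + 2 * i, 10 * s + 4 + i)) ++
      (List.range (s - 7)).map (fun i => (2 * s + 9 + 2 * i, 7 * s + 5 + i)) ++
      (List.range (s - 5)).map (fun i => (7 + 2 * i, 6 * s + 8 + i)) ++
      [(3, 5 * s + 5), (4, 5 * s + 4), (5, 5 * s + 6), (2 * s + 1, 10 * s - 1),
      (2 * s + 3, 6 * s + 6), (2 * s + 5, 7 * s + 3), (2 * s + 7, 6 * s + 4),
      (4 * s - 5, 10 * s + 2), (5 * s - 3, 10 * s), (5 * s - 1, 12 * s + 3)])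
    [(4 * s - 2, 10 * s + 1, 10 * s + 3, 12 * s),
      (4 * s + 2, 8 * s + 1, 12 * s + 1, 12 * s + 2)] ?_ ?_ ?_ ?_
  · simp only [List.forall_mem_append, List.forall_mem_cons, List.forall_mem_map, List.mem_range,
      List.not_mem_nil, IsEmpty.forall_iff, implies_true, and_true]
    refine ⟨⟨⟨fun i hi => ?_, fun i hi => ?_⟩, fun i hi => ?_⟩, ?_⟩ <;> omega
  · simp only [List.forall_mem_cons, List.not_mem_nil, IsEmpty.forall_iff, implies_true, and_true]
    omega
  · simp only [List.length_append, List.length_map, List.length_range, List.length_cons,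
      List.length_nil]
    omega
  · intro d hd hd0 hdt
    simp only [List.forall_mem_append, List.forall_mem_cons, List.forall_mem_map, List.mem_range,
      List.not_mem_nil, IsEmpty.forall_iff, implies_true, and_true]
    rintro ⟨⟨⟨⟨h1, h2⟩, h3⟩, ⟨e0a, e0b, e0c⟩, ⟨e1a, e1b, e1c⟩,
      ⟨e2a, e2b, e2c⟩, ⟨e3a, e3b, e3c⟩, ⟨e4a, e4b, e4c⟩, ⟨e5a,
      e5b, e5c⟩, ⟨e6a, e6b, e6c⟩, ⟨e7a, e7b, e7c⟩, ⟨e8a, e8b,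
      e8c⟩, ⟨e9a, e9b, e9c⟩⟩, ⟨r0a, r0b, r0c, r0d, r0e, r0f,
      r0g, r0h, r0i, r0j⟩, ⟨r1a, r1b, r1c, r1d, r1e, r1f,
      r1g, r1h, r1i, r1j⟩⟩
    obtain ⟨f1a, f1b, f1c⟩ := ne_of_forall_range h1
    obtain ⟨f2a, f2b, f2c⟩ := ne_of_forall_range h2
    obtain ⟨f3a, f3b, f3c⟩ := ne_of_forall_range h3
    rcases lt_or_ge d 6 with u0 | k0
    · clear * - hs hd0 u0 r1j r0h e0a e1a e2a
      omega
    rcases lt_or_ge d (2 * s - 3) with u1 | k1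
    · clear * - hs k0 u1 f1a f3a
      omega
    rcases lt_or_ge d (2 * s + 8) with u2 | k2
    · clear * - hs k1 u2 f1a r0j r0i e3a e4a e5a e6a
      omega
    rcases lt_or_ge d (4 * s - 5) with u3 | k3
    · clear * - hs k2 u3 f1a f2a
      omega
    rcases lt_or_ge d (4 * s + 4) with u4 | k4
    · clear * - hs k3 u4 f1a e7a e6c r0a r1e r1h r1i r1a e4c
      omega
    rcases lt_or_ge d (5 * s - 3) with u5 | k5
    · clear * - hs k4 u5 f2c
      omega
    rcases lt_or_ge d (5 * s + 7) with u6 | k6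
    · clear * - hs k5 u6 e8a e5c e9a e1c e2c e0c e8c e1b e0b e2b
      omega
    rcases lt_or_ge d (6 * s + 2) with u7 | k7
    · clear * - hs k6 u7 f3c
      omega
    rcases lt_or_ge d (6 * s + 8) with u8 | k8
    · clear * - hs k7 u8 hdt r0e e6b r0f e4b e7c
      omega
    rcases lt_or_ge d (7 * s + 3) with u9 | k9
    · clear * - hs k8 u9 f3b
      omega
    rcases lt_or_ge d (7 * s + 5) with u10 | k10
    · clear * - hs k9 u10 e5b e9c
      omega
    rcases lt_or_ge d (8 * s - 2) with u11 | k11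
    · clear * - hs k10 u11 f2b
      omega
    rcases lt_or_ge d (8 * s + 3) with u12 | k12
    · clear * - hs k11 u12 e3c r1f r1g r1b r0g
      omega
    rcases lt_or_ge d (10 * s - 1) with u13 | k13
    · clear * - hs k12 u13 f1c
      omega
    rcases lt_or_ge d (10 * s + 4) with u14 | k14
    · clear * - hs k13 u14 e3b e8b r0b e7b r0c
      omega
    rcases lt_or_ge d (12 * s) with u15 | k15
    · clear * - hs k14 u15 f1b
      omega
    clear * - hs k15 hd r0d r1c r1d e9b
    omega

/-- Here 3 divides 2t - 2, so triples suffice; the even run starts at 4 and sixteen sporadic triples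
close the gaps. -/
theorem exists_isPDF_six_mul_add_four (s : ℕ) (hs : 6 ≤ s) :
    ∃ F : Multiset (Finset (ZMod (4 * (6 * s + 4)))), IsPDF 4 (6 * s + 4) {3, 5} F := by
  refine exists_isPDF_of_lists (6 * s + 4) (by omega)
    ((List.range (2 * s - 3)).map (fun i => (4 + 2 * i, 10 * s + 6 + i)) ++
      (List.range (s - 6)).map (fun i => (2 * s + 7 + 2 * i, 7 * s + 5 + i)) ++
      (List.range (s - 5)).map (fun i => (7 + 2 * i, 6 * s + 6 + i)) ++
      [(1, 6 * s + 2), (2, 12 * s + 5), (3, 7 * s + 4), (5, 4 * s), (2 * s - 3, 8 * s + 2),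
      (2 * s - 1, 6 * s), (2 * s + 1, 8 * s + 4), (2 * s + 3, 7 * s + 2),
      (2 * s + 5, 10 * s + 5), (4 * s - 3, 8 * s - 1), (4 * s - 2, 8 * s + 1),
      (4 * s - 1, 12 * s + 4), (4 * s + 4, 12 * s + 7), (5 * s, 10 * s + 4),
      (5 * s + 1, 10 * s + 3), (5 * s + 3, 12 * s + 6)])
    [] ?_ ?_ ?_ ?_
  · simp only [List.forall_mem_append, List.forall_mem_cons, List.forall_mem_map, List.mem_range,
      List.not_mem_nil, IsEmpty.forall_iff, implies_true, and_true]
    refine ⟨⟨⟨fun i hi => ?_, fun i hi => ?_⟩, fun i hi => ?_⟩, ?_⟩ <;> omega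
  · simp only [List.not_mem_nil, IsEmpty.forall_iff, implies_true]
  · simp only [List.length_append, List.length_map, List.length_range, List.length_cons,
      List.length_nil]
    omega
  · intro d hd hd0 hdt
    simp only [List.forall_mem_append, List.forall_mem_cons, List.forall_mem_map, List.mem_range,
      List.not_mem_nil, IsEmpty.forall_iff, implies_true, and_true]
    rintro ⟨⟨⟨h1, h2⟩, h3⟩, ⟨e0a, e0b, e0c⟩, ⟨e1a, e1b, e1c⟩, ⟨e2a,
      e2b, e2c⟩, ⟨e3a, e3b, e3c⟩, ⟨e4a, e4b, e4c⟩, ⟨e5a, e5b,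
      e5c⟩, ⟨e6a, e6b, e6c⟩, ⟨e7a, e7b, e7c⟩, ⟨e8a, e8b, e8c⟩,
      ⟨e9a, e9b, e9c⟩, ⟨e10a, e10b, e10c⟩, ⟨e11a, e11b, e11c⟩,
      ⟨e12a, e12b, e12c⟩, ⟨e13a, e13b, e13c⟩, ⟨e14a, e14b,
      e14c⟩, ⟨e15a, e15b, e15c⟩⟩
    obtain ⟨f1a, f1b, f1c⟩ := ne_of_forall_range h1
    obtain ⟨f2a, f2b, f2c⟩ := ne_of_forall_range h2
    obtain ⟨f3a, f3b, f3c⟩ := ne_of_forall_range h3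
    rcases lt_or_ge d 6 with u0 | k0
    · clear * - hs hd0 u0 f1a e0a e1a e2a e3a
      omega
    rcases lt_or_ge d (2 * s - 3) with u1 | k1
    · clear * - hs k0 u1 f1a f3a
      omega
    rcases lt_or_ge d (2 * s + 6) with u2 | k2
    · clear * - hs k1 u2 f1a e4a e5a e6a e7a e8a
      omega
    rcases lt_or_ge d (4 * s - 5) with u3 | k3
    · clear * - hs k2 u3 f1a f2a
      omega
    rcases lt_or_ge d (4 * s + 5) with u4 | k4
    · clear * - hs k3 u4 f1a e3c e9a e10a e11a e3b e5c e9c e10c e12a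
      omega
    rcases lt_or_ge d (5 * s - 1) with u5 | k5
    · clear * - hs k4 u5 f2c
      omega
    rcases lt_or_ge d (5 * s + 5) with u6 | k6
    · clear * - hs k5 u6 e7c e13a e14a e14c e15a e13c
      omega
    rcases lt_or_ge d (6 * s) with u7 | k7
    · clear * - hs k6 u7 f3c
      omega
    rcases lt_or_ge d (6 * s + 6) with u8 | k8
    · clear * - hs k7 u8 e5b e0c e0b e6c hdt e4c
      omega
    rcases lt_or_ge d (7 * s + 1) with u9 | k9
    · clear * - hs k8 u9 f3b
      omega
    rcases lt_or_ge d (7 * s + 5) with u10 | k10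
    · clear * - hs k9 u10 e2c e7b e15c e2b
      omega
    rcases lt_or_ge d (8 * s - 1) with u11 | k11
    · clear * - hs k10 u11 f2b
      omega
    rcases lt_or_ge d (8 * s + 6) with u12 | k12
    · clear * - hs k11 u12 e9b e8c e10b e4b e12c e6b e11c
      omega
    rcases lt_or_ge d (10 * s + 3) with u13 | k13
    · clear * - hs k12 u13 f1c
      omega
    rcases lt_or_ge d (10 * s + 6) with u14 | k14
    · clear * - hs k13 u14 e14b e13b e8b
      omega
    rcases lt_or_ge d (12 * s + 3) with u15 | k15
    · clear * - hs k14 u15 f1b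
      omega
    clear * - hs k15 hd e1c e11b e1b e15b e12b
    omega

/-! ### Small orders. -/

/-- Coverage rephrased as membership in an explicit list of differences, which can be decided by
evaluation for concrete t. -/
theorem exists_isPDF_of_mem_lists (t : ℕ) (ht : 0 < t) (T : List (ℕ × ℕ)) (R : List (ℕ × ℕ × ℕ × ℕ))
    (hT : ∀ p ∈ T, 0 < p.1 ∧ p.1 < p.2)
    (hR : ∀ r ∈ R, 0 < r.1 ∧ r.1 < r.2.1 ∧ r.2.1 < r.2.2.1 ∧ r.2.2.1 < r.2.2.2)
    (hlen : 3 * T.length + 10 * R.length = 2 * t - 2)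
    (hcov : ∀ d < 2 * t, 0 < d → d ≠ t →
      d ∈ (T.flatMap fun p => [p.1, p.2, p.2 - p.1]) ++
        R.flatMap fun r => [r.1, r.2.1, r.2.2.1, r.2.2.2, r.2.1 - r.1, r.2.2.1 - r.1,
          r.2.2.2 - r.1, r.2.2.1 - r.2.1, r.2.2.2 - r.2.1, r.2.2.2 - r.2.2.1]) :
    ∃ F : Multiset (Finset (ZMod (4 * t))), IsPDF 4 t {3, 5} F := by
  refine exists_isPDF_of_lists t ht T R hT hR hlen fun d hd hd0 hdt => ?_
  rintro ⟨h3, h5⟩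
  rcases List.mem_append.1 (hcov d hd hd0 hdt) with h | h
  · obtain ⟨p, hp, hd⟩ := List.mem_flatMap.1 h
    have := hT p hp
    have := h3 p hp
    simp only [List.mem_cons, List.not_mem_nil, or_false] at hd
    omega
  · obtain ⟨r, hr, hd⟩ := List.mem_flatMap.1 h
    have := hR r hr
    have := h5 r hr
    simp only [List.mem_cons, List.not_mem_nil, or_false] at hd
    omega

theorem exists_isPDF_4 : ∃ F : Multiset (Finset (ZMod (4 * 4))), IsPDF 4 4 {3, 5} F :=
  exists_isPDF_of_mem_lists 4 (by decide)
    [(1, 7), (2, 5)]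
    [] (by decide) (by decide) rfl (by decide)

theorem exists_isPDF_6 : ∃ F : Multiset (Finset (ZMod (4 * 6))), IsPDF 4 6 {3, 5} F :=
  exists_isPDF_of_mem_lists 6 (by decide)
    []
    [(2, 7, 10, 11)] (by decide) (by decide) rfl (by decide)

theorem exists_isPDF_10 : ∃ F : Multiset (Finset (ZMod (4 * 10))), IsPDF 4 10 {3, 5} F :=
  exists_isPDF_of_mem_lists 10 (by decide)
    [(1, 19), (2, 17), (3, 11), (4, 16), (5, 14), (6, 13)]
    [] (by decide) (by decide) rfl (by decide)

theorem exists_isPDF_12 : ∃ F : Multiset (Finset (ZMod (4 * 12))), IsPDF 4 12 {3, 5} F :=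
  exists_isPDF_of_mem_lists 12 (by decide)
    [(1, 23), (4, 21), (6, 20), (9, 19)]
    [(2, 7, 15, 18)] (by decide) (by decide) rfl (by decide)

theorem exists_isPDF_14 : ∃ F : Multiset (Finset (ZMod (4 * 14))), IsPDF 4 14 {3, 5} F :=
  exists_isPDF_of_mem_lists 14 (by decide)
    [(5, 22), (12, 25)]
    [(3, 21, 23, 27), (10, 11, 19, 26)] (by decide) (by decide) rfl (by decide)

theorem exists_isPDF_16 : ∃ F : Multiset (Finset (ZMod (4 * 16))), IsPDF 4 16 {3, 5} F :=
  exists_isPDF_of_mem_lists 16 (by decide)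
    [(1, 31), (2, 29), (3, 28), (4, 19), (5, 26), (6, 23), (7, 18),
      (8, 20), (9, 22), (10, 24)]
    [] (by decide) (by decide) rfl (by decide)

theorem exists_isPDF_18 : ∃ F : Multiset (Finset (ZMod (4 * 18))), IsPDF 4 18 {3, 5} F :=
  exists_isPDF_of_mem_lists 18 (by decide)
    [(1, 21), (3, 32), (4, 31), (5, 30), (7, 35), (10, 23), (12, 26),
      (15, 34)]
    [(16, 22, 24, 33)] (by decide) (by decide) rfl (by decide)

theorem exists_isPDF_20 : ∃ F : Multiset (Finset (ZMod (4 * 20))), IsPDF 4 20 {3, 5} F :=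
  exists_isPDF_of_mem_lists 20 (by decide)
    [(5, 23), (6, 27), (9, 26), (11, 30), (12, 28), (13, 38)]
    [(7, 15, 29, 39), (2, 33, 36, 37)] (by decide) (by decide) rfl (by decide)

theorem exists_isPDF_22 : ∃ F : Multiset (Finset (ZMod (4 * 22))), IsPDF 4 22 {3, 5} F :=
  exists_isPDF_of_mem_lists 22 (by decide)
    [(1, 43), (2, 41), (3, 40), (4, 38), (5, 36), (6, 29), (7, 24),
      (8, 26), (9, 28), (10, 35), (11, 32), (12, 27), (13, 33), (14, 30)]
    [] (by decide) (by decide) rfl (by decide)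

theorem exists_isPDF_24 : ∃ F : Multiset (Finset (ZMod (4 * 24))), IsPDF 4 24 {3, 5} F :=
  exists_isPDF_of_mem_lists 24 (by decide)
    [(1, 18), (2, 45), (3, 44), (4, 42), (5, 40), (6, 28), (7, 37),
      (9, 32), (10, 39), (11, 36), (15, 31), (19, 46)]
    [(13, 21, 33, 47)] (by decide) (by decide) rfl (by decide)

theorem exists_isPDF_26 : ∃ F : Multiset (Finset (ZMod (4 * 26))), IsPDF 4 26 {3, 5} F :=
  exists_isPDF_of_mem_lists 26 (by decide)
    [(2, 36), (4, 45), (5, 38), (7, 51), (9, 40), (10, 30), (13, 48),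
      (14, 43), (16, 37), (17, 49)]
    [(22, 28, 46, 47), (27, 39, 42, 50)] (by decide) (by decide) rfl (by decide)

theorem exists_isPDF_28 : ∃ F : Multiset (Finset (ZMod (4 * 28))), IsPDF 4 28 {3, 5} F :=
  exists_isPDF_of_mem_lists 28 (by decide)
    [(1, 26), (2, 19), (3, 52), (4, 50), (5, 48), (6, 47), (7, 45),
      (8, 42), (9, 31), (10, 39), (11, 32), (12, 35), (13, 33), (14, 44),
      (15, 55), (16, 53), (18, 54), (24, 51)]
    [] (by decide) (by decide) rfl (by decide)

theorem exists_isPDF_32 : ∃ F : Multiset (Finset (ZMod (4 * 32))), IsPDF 4 32 {3, 5} F :=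
  exists_isPDF_of_mem_lists 32 (by decide)
    [(2, 43), (3, 53), (5, 42), (6, 60), (7, 58), (9, 61), (10, 56),
      (11, 49), (14, 44), (15, 48), (18, 63), (24, 55), (27, 62), (28, 57)]
    [(23, 39, 40, 59), (13, 21, 25, 47)] (by decide) (by decide) rfl (by decide)

theorem exists_isPDF_34 : ∃ F : Multiset (Finset (ZMod (4 * 34))), IsPDF 4 34 {3, 5} F :=
  exists_isPDF_of_mem_lists 34 (by decide)
    [(1, 67), (2, 65), (3, 57), (4, 62), (5, 46), (6, 53), (7, 35),
      (8, 56), (9, 60), (10, 37), (11, 44), (12, 43), (13, 36), (14, 64),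
      (15, 39), (16, 61), (17, 42), (18, 40), (19, 49), (20, 52), (21, 59),
      (26, 55)]
    [] (by decide) (by decide) rfl (by decide)

theorem exists_isPDF_38 : ∃ F : Multiset (Finset (ZMod (4 * 38))), IsPDF 4 38 {3, 5} F :=
  exists_isPDF_of_mem_lists 38 (by decide)
    [(1, 43), (2, 74), (3, 73), (5, 33), (7, 65), (8, 60), (9, 63),
      (10, 51), (12, 59), (13, 61), (14, 69), (16, 62), (20, 49), (22, 75),
      (23, 57), (25, 64), (27, 71), (31, 68)]
    [(21, 36, 40, 66), (32, 50, 56, 67)] (by decide) (by decide) rfl (by decide)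

/-! ### Assembly of all orders. -/

theorem exists_isPDF_of_even {t : ℕ} (ht : Even t) (h4 : 4 ≤ t) (h8 : t ≠ 8) :
    ∃ F : Multiset (Finset (ZMod (4 * t))), IsPDF 4 t {3, 5} F := by
  -- From 40 on every even t lies in the range of its family: 38 = 6·6 + 2 is the last even order
  -- that none of the families reaches. Below 40, the orders 30 and 36 already belong to the family
  -- 6s.
  by_cases hlarge : 40 ≤ t
  · have hmod : t % 6 = 0 ∨ t % 6 = 2 ∨ t % 6 = 4 := by
      obtain ⟨k, rfl⟩ := ht
      omega
    rcases hmod with h | h | h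
    · obtain ⟨s, rfl⟩ : ∃ s, t = 6 * s := ⟨t / 6, by omega⟩
      exact exists_isPDF_six_mul s (by omega)
    · obtain ⟨s, rfl⟩ : ∃ s, t = 6 * s + 2 := ⟨t / 6, by omega⟩
      exact exists_isPDF_six_mul_add_two s (by omega)
    · obtain ⟨s, rfl⟩ : ∃ s, t = 6 * s + 4 := ⟨t / 6, by omega⟩
      exact exists_isPDF_six_mul_add_four s (by omega)
  · have hcases : t = 4 ∨ t = 6 ∨ t = 10 ∨ t = 12 ∨ t = 14 ∨ t = 16 ∨ t = 18 ∨ t = 20 ∨ t = 22 ∨ t = 24 ∨ t = 26 ∨ t = 28 ∨ t = 30 ∨ t = 32 ∨ t = 34 ∨ t = 36 ∨ t = 38 := by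
      obtain ⟨k, rfl⟩ := ht
      omega
    rcases hcases with rfl | rfl | rfl | rfl | rfl | rfl | rfl | rfl | rfl | rfl | rfl | rfl | rfl | rfl | rfl | rfl | rfl
    · exact exists_isPDF_4
    · exact exists_isPDF_6
    · exact exists_isPDF_10
    · exact exists_isPDF_12
    · exact exists_isPDF_14
    · exact exists_isPDF_16
    · exact exists_isPDF_18
    · exact exists_isPDF_20
    · exact exists_isPDF_22
    · exact exists_isPDF_24
    · exact exists_isPDF_26
    · exact exists_isPDF_28
    · exact exists_isPDF_six_mul 5 (by norm_num)
    · exact exists_isPDF_32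
    · exact exists_isPDF_34
    · exact exists_isPDF_six_mul 6 (by norm_num)
    · exact exists_isPDF_38

theorem lemma4p9 (t : ℕ) (ht : Even t) (h4 : 4 ≤ t) (h8 : t ≠ 8) :
    (∃ F : Multiset (Finset (ZMod (4 * t))), IsPDF 4 t {3, 5} F) ∧
      ∃ F : Multiset (Finset (Fin 3 × ZMod (4 * t))), IsPerfectSCHGDD 3 3 4 t F := by
  obtain ⟨F, hF⟩ := exists_isPDF_of_even ht h4 h8
  exact ⟨⟨F, hF⟩, hF.exists_isPerfectSCHGDD (by norm_num) (by omega)⟩
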